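/- By a $C^*$-algebra we mean a complex, not necessarily unital or separable, $C^*$-algebra, and for $C^*$-algebras $C$ and $A$ let $\mathrm{Hom}(C,A)$ be the set of all $*$-homomorphisms $C\to A$ (not required to preserve units). Two elements $f_0,f_1\in \mathrm{Hom}(C,A)$ are homotopic if there is a $*$-homomorphism $F:C\to C([0,1],A)$ with $F(c)(0)=f_0(c)$ and $F(c)(1)=f_1(c)$ for all $c\in C$. Two $C^*$-algebras $A$ and $B$ are called weakly homotopy equivalent if for every separable $C^*$-algebra $C$ there are maps $\varphi_C:\mathrm{Hom}(C,A)\to \mathrm{Hom}(C,B)$ and $\psi_C:\mathrm{Hom}(C,B)\to \mathrm{Hom}(C,A)$ that are natural in $C$ (that is, $\varphi_D(f\circ h)=\varphi_C(f)\circ h$ and $\psi_D(g\circ h)=\psi_C(g)\circ h$ for every $*$-homomorphism $h:D\to C$ of separable $C^*$-algebras), send homotopic $*$-homomorphisms to homotopic ones, and are such that for every separable $C$ the $*$-homomorphism $\psi_C(\varphi_C(f))$ is homotopic to $f$ for all $f\in \mathrm{Hom}(C,A)$, and $\varphi_C(\psi_C(g))$ is homotopic to $g$ for all $g\in \mathrm{Hom}(C,B)$.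 **Lemma.** If $A$ and $B$ are weakly homotopy equivalent $C^*$-algebras, then $K_0(A)\cong K_0(B)$ and $K_1(A)\cong K_1(B)$ as abelian groups. Here, for a unital $C^*$-algebra $D$, $K_0(D)$ is the abelian group generated by the symbols $[p]$, $p$ a projection in $M_n(D)$, $n\in\mathbb N$, subject to the relations $[p]=[q]$ if $p,q\in M_n(D)$ are joined by a norm-continuous path of projections in $M_n(D)$, $[0]=0$, and $[p]+[q]=[p\oplus q]$; and $K_1(D)$ is the abelian group generated by the symbols $[w]$, $w$ a unitary in $M_n(D)$, subject to $[w]=[z]$ if $w,z\in M_n(D)$ are joined by a norm-continuous path of unitaries in $M_n(D)$, $[1]=0$, and $[w]+[z]=[w\oplus z]$. For an arbitrary $C^*$-algebra $A$ with unitization $A^+$ (a unit being adjoined even if $A$ has one), $K_0(A)=\ker(K_0(A^+)\to K_0(\mathbb C))$ and $K_1(A)=K_1(A^+)$. -/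

import Mathlib

open scoped unitInterval

universe u v

section Homotopy

/-- Two `*`-homomorphisms `f₀ f₁ : C → B` of (not necessarily unital) C⋆-algebras are homotopic
if there is a `*`-homomorphism `F : C → C([0,1], B)` with `ev₀ ∘ F = f₀` and `ev₁ ∘ F = f₁`. -/
def StarHomotopic {C : Type u} {B : Type v} [NonUnitalCStarAlgebra C] [NonUnitalCStarAlgebra B]
    (f₀ f₁ : C →⋆ₙₐ[ℂ] B) : Prop :=
  ∃ F : C →⋆ₙₐ[ℂ] C(I, B), (∀ c, F c 0 = f₀ c) ∧ (∀ c, F c 1 = f₁ c)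

/-- A map from `*`-homomorphisms `C → A` to `*`-homomorphisms `C → B`, one for every separable
C⋆-algebra `C`. -/
abbrev SeparableHomMap (A B : Type u) [NonUnitalCStarAlgebra A] [NonUnitalCStarAlgebra B] :
    Type (u + 1) :=
  ∀ (C : Type u) [NonUnitalCStarAlgebra C] [TopologicalSpace.SeparableSpace C],
    (C →⋆ₙₐ[ℂ] A) → (C →⋆ₙₐ[ℂ] B)

/-- Naturality in the separable C⋆-algebra `C`. -/
def SeparableHomMap.IsNatural {A B : Type u} [NonUnitalCStarAlgebra A] [NonUnitalCStarAlgebra B]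
    (φ : SeparableHomMap A B) : Prop :=
  ∀ (C D : Type u) [NonUnitalCStarAlgebra C] [TopologicalSpace.SeparableSpace C]
    [NonUnitalCStarAlgebra D] [TopologicalSpace.SeparableSpace D]
    (h : D →⋆ₙₐ[ℂ] C) (f : C →⋆ₙₐ[ℂ] A), φ D (f.comp h) = (φ C f).comp h

/-- Homotopic `*`-homomorphisms are sent to homotopic ones. -/
def SeparableHomMap.PreservesHomotopy {A B : Type u} [NonUnitalCStarAlgebra A]
    [NonUnitalCStarAlgebra B] (φ : SeparableHomMap A B) : Prop :=
  ∀ (C : Type u) [NonUnitalCStarAlgebra C] [TopologicalSpace.SeparableSpace C]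
    (f₀ f₁ : C →⋆ₙₐ[ℂ] A), StarHomotopic f₀ f₁ → StarHomotopic (φ C f₀) (φ C f₁)

/-- Weak homotopy equivalence of C⋆-algebras. -/
def WeaklyHomotopyEquivalent (A B : Type u) [NonUnitalCStarAlgebra A]
    [NonUnitalCStarAlgebra B] : Prop :=
  ∃ (φ : SeparableHomMap A B) (ψ : SeparableHomMap B A),
    φ.IsNatural ∧ ψ.IsNatural ∧ φ.PreservesHomotopy ∧ ψ.PreservesHomotopy ∧
    (∀ (C : Type u) [NonUnitalCStarAlgebra C] [TopologicalSpace.SeparableSpace C]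
      (f : C →⋆ₙₐ[ℂ] A), StarHomotopic (ψ C (φ C f)) f) ∧
    (∀ (C : Type u) [NonUnitalCStarAlgebra C] [TopologicalSpace.SeparableSpace C]
      (g : C →⋆ₙₐ[ℂ] B), StarHomotopic (φ C (ψ C g)) g)

end Homotopy

namespace KTheory

/-! The topology on `Matrix (Fin n) (Fin n) A` is the entrywise one, which is the topology of the
C⋆-norm on `Mₙ(A)`; `star` is the conjugate transpose. -/

/-- The block sum `x ⊕ y = diag(x, y)` in `M_{m+n}(A)`. -/
def blockSum {A : Type u} [Zero A] {m n : ℕ} (x : Matrix (Fin m) (Fin m) A)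
    (y : Matrix (Fin n) (Fin n) A) : Matrix (Fin (m + n)) (Fin (m + n)) A :=
  Matrix.reindex finSumFinEquiv finSumFinEquiv (Matrix.fromBlocks x 0 0 y)

section Unital

variable (A : Type u) [CStarAlgebra A]

/-- Projections in `Mₙ(A)`, `n ∈ ℕ`. -/
abbrev MatProj : Type u :=
  Σ n : ℕ, {p : Matrix (Fin n) (Fin n) A // IsStarProjection p}

/-- Unitaries in `Mₙ(A)`, `n ∈ ℕ`. -/
abbrev MatUnitary : Type u :=
  Σ n : ℕ, {w : Matrix (Fin n) (Fin n) A // w ∈ unitary (Matrix (Fin n) (Fin n) A)}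

variable {A}

theorem star_blockSum {m n : ℕ} (x : Matrix (Fin m) (Fin m) A) (y : Matrix (Fin n) (Fin n) A) :
    star (blockSum x y) = blockSum (star x) (star y) := by
  simp [blockSum, Matrix.star_eq_conjTranspose, Matrix.fromBlocks_conjTranspose]

theorem blockSum_mul {m n : ℕ} (x x' : Matrix (Fin m) (Fin m) A)
    (y y' : Matrix (Fin n) (Fin n) A) :
    blockSum x y * blockSum x' y' = blockSum (x * x') (y * y') := by
  simp [blockSum, Matrix.submatrix_mul_equiv, Matrix.fromBlocks_multiply]

theorem blockSum_one {m n : ℕ} :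
    blockSum (1 : Matrix (Fin m) (Fin m) A) (1 : Matrix (Fin n) (Fin n) A) = 1 := by
  simp [blockSum, Matrix.fromBlocks_one]

theorem isStarProjection_blockSum {m n : ℕ} {p : Matrix (Fin m) (Fin m) A}
    {q : Matrix (Fin n) (Fin n) A} (hp : IsStarProjection p) (hq : IsStarProjection q) :
    IsStarProjection (blockSum p q) where
  isIdempotentElem := by
    rw [IsIdempotentElem, blockSum_mul, hp.isIdempotentElem, hq.isIdempotentElem]
  isSelfAdjoint := by
    rw [IsSelfAdjoint, star_blockSum, hp.isSelfAdjoint, hq.isSelfAdjoint]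

theorem blockSum_mem_unitary {m n : ℕ} {w : Matrix (Fin m) (Fin m) A}
    {z : Matrix (Fin n) (Fin n) A} (hw : w ∈ unitary (Matrix (Fin m) (Fin m) A))
    (hz : z ∈ unitary (Matrix (Fin n) (Fin n) A)) :
    blockSum w z ∈ unitary (Matrix (Fin (m + n)) (Fin (m + n)) A) := by
  rw [Unitary.mem_iff] at *
  rw [star_blockSum, blockSum_mul, blockSum_mul, hw.1, hw.2, hz.1, hz.2, blockSum_one]
  exact ⟨rfl, rfl⟩

variable (A)

/-- The defining relations of `K₀` of a unital C⋆-algebra: `[p] = [q]` if `p, q ∈ Mₙ(A)` are joined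
by a path of projections in `Mₙ(A)`; `[0] = 0`; and `[p] + [q] = [p ⊕ q]`. -/
inductive K0Rel : FreeAbelianGroup (MatProj A) → Prop
  | path {n : ℕ} (p q : Matrix (Fin n) (Fin n) A) (hp : IsStarProjection p)
      (hq : IsStarProjection q) (h : JoinedIn {r | IsStarProjection r} p q) :
      K0Rel (FreeAbelianGroup.of ⟨n, p, hp⟩ - FreeAbelianGroup.of ⟨n, q, hq⟩)
  | zero (n : ℕ) : K0Rel (FreeAbelianGroup.of ⟨n, 0, IsStarProjection.zero _⟩)
  | sum {m n : ℕ} (p : Matrix (Fin m) (Fin m) A) (q : Matrix (Fin n) (Fin n) A)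
      (hp : IsStarProjection p) (hq : IsStarProjection q) :
      K0Rel (FreeAbelianGroup.of ⟨m, p, hp⟩ + FreeAbelianGroup.of ⟨n, q, hq⟩
        - FreeAbelianGroup.of ⟨m + n, blockSum p q, isStarProjection_blockSum hp hq⟩)

/-- The defining relations of `K₁` of a unital C⋆-algebra: `[w] = [z]` if `w, z ∈ Uₙ(A)` are joined
by a path in `Uₙ(A)`; `[1] = 0`; and `[w] + [z] = [w ⊕ z]`. -/
inductive K1Rel : FreeAbelianGroup (MatUnitary A) → Prop
  | path {n : ℕ} (w z : Matrix (Fin n) (Fin n) A) (hw : w ∈ unitary (Matrix (Fin n) (Fin n) A))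
      (hz : z ∈ unitary (Matrix (Fin n) (Fin n) A))
      (h : JoinedIn (unitary (Matrix (Fin n) (Fin n) A) : Set (Matrix (Fin n) (Fin n) A)) w z) :
      K1Rel (FreeAbelianGroup.of ⟨n, w, hw⟩ - FreeAbelianGroup.of ⟨n, z, hz⟩)
  | one (n : ℕ) : K1Rel (FreeAbelianGroup.of ⟨n, 1, one_mem _⟩)
  | sum {m n : ℕ} (w : Matrix (Fin m) (Fin m) A) (z : Matrix (Fin n) (Fin n) A)
      (hw : w ∈ unitary (Matrix (Fin m) (Fin m) A))
      (hz : z ∈ unitary (Matrix (Fin n) (Fin n) A)) :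
      K1Rel (FreeAbelianGroup.of ⟨m, w, hw⟩ + FreeAbelianGroup.of ⟨n, z, hz⟩
        - FreeAbelianGroup.of ⟨m + n, blockSum w z, blockSum_mem_unitary hw hz⟩)

/-- `K₀` of a unital C⋆-algebra. -/
abbrev K0Unital : Type u :=
  FreeAbelianGroup (MatProj A) ⧸ AddSubgroup.closure {x | K0Rel A x}

/-- `K₁` of a unital C⋆-algebra. -/
abbrev K1Unital : Type u :=
  FreeAbelianGroup (MatUnitary A) ⧸ AddSubgroup.closure {x | K1Rel A x}

end Unital

section Functoriality

variable {A : Type u} {B : Type v} [CStarAlgebra A] [CStarAlgebra B]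

theorem isStarProjection_map (f : A →⋆ₐ[ℂ] B) {n : ℕ} {p : Matrix (Fin n) (Fin n) A}
    (hp : IsStarProjection p) : IsStarProjection (p.map f) where
  isIdempotentElem := by
    rw [IsIdempotentElem, ← Matrix.map_mul, hp.isIdempotentElem]
  isSelfAdjoint := by
    have h := hp.isSelfAdjoint
    rw [IsSelfAdjoint, Matrix.star_eq_conjTranspose] at h ⊢
    rw [← Matrix.conjTranspose_map f (fun a => map_star f a), h]

theorem map_blockSum (f : A →⋆ₐ[ℂ] B) {m n : ℕ} (x : Matrix (Fin m) (Fin m) A)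
    (y : Matrix (Fin n) (Fin n) A) :
    (blockSum x y).map f = blockSum (x.map f) (y.map f) := by
  simp [blockSum, ← Matrix.submatrix_map, Matrix.fromBlocks_map]

/-- Entrywise application of a unital `*`-homomorphism to matrix projections. -/
def MatProj.map (f : A →⋆ₐ[ℂ] B) (p : MatProj A) : MatProj B :=
  ⟨p.1, p.2.1.map f, isStarProjection_map f p.2.2⟩

theorem K0Rel.map (f : A →⋆ₐ[ℂ] B) {x : FreeAbelianGroup (MatProj A)} (hx : K0Rel A x) :
    K0Rel B (FreeAbelianGroup.map (MatProj.map f) x) := by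
  cases hx with
  | @path n p q hp hq h =>
    simp only [map_sub, FreeAbelianGroup.map_of_apply, MatProj.map]
    refine K0Rel.path _ _ _ _ ?_
    have hc : Continuous (fun r : Matrix (Fin n) (Fin n) A => r.map f) :=
      continuous_id.matrix_map
        (NonUnitalStarAlgHom.instContinuousLinearMapClassComplex (F := A →⋆ₐ[ℂ] B).map_continuous f)
    obtain ⟨γ, hγ⟩ := h
    exact ⟨γ.map hc, fun t => isStarProjection_map f (hγ t)⟩
  | zero n =>
    simp only [FreeAbelianGroup.map_of_apply, MatProj.map, Matrix.map_zero f (map_zero f)]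
    exact K0Rel.zero n
  | sum p q hp hq =>
    simp only [map_sub, map_add, FreeAbelianGroup.map_of_apply, MatProj.map, map_blockSum]
    exact K0Rel.sum _ _ _ _

/-- The homomorphism `K₀(A) → K₀(B)` induced by a unital `*`-homomorphism `A → B`. -/
def K0Unital.map (f : A →⋆ₐ[ℂ] B) : K0Unital A →+ K0Unital B :=
  QuotientAddGroup.map _ _ (FreeAbelianGroup.map (MatProj.map f)) <| by
    rw [AddSubgroup.closure_le]
    exact fun x hx => AddSubgroup.subset_closure (K0Rel.map f hx)

end Functoriality

section NonUnital

variable (A : Type u) [NonUnitalCStarAlgebra A]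

/-- The quotient `*`-homomorphism `A⁺ → ℂ` of the unitization `A⁺` of `A`. -/
def augmentation : Unitization ℂ A →⋆ₐ[ℂ] ℂ :=
  { Unitization.fstHom ℂ A with map_star' := fun x => Unitization.fst_star x }

/-- `K₀(A) = ker (K₀(A⁺) → K₀(ℂ))`. -/
abbrev K0 : Type u :=
  (K0Unital.map (augmentation A)).ker

/-- `K₁(A) = K₁(A⁺)`. -/
abbrev K1 : Type u :=
  K1Unital (Unitization ℂ A)

end NonUnital

end KTheory

/-!
Every C⋆-algebra is the directed union of its separable C⋆-subalgebras, so a natural map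
`Hom(C, A) → Hom(C, B)`, `C` separable, is composition with a single `*`-homomorphism `A → B`. A
weak homotopy equivalence therefore amounts to `*`-homomorphisms `f : A → B` and `g : B → A` such
that `g ∘ f` and `f ∘ g` become homotopic to the inclusions on separable subalgebras. The finitely
many entries of a projection or unitary over `A⁺` lie in `S⁺` for a separable C⋆-subalgebra `S` of
`A`, where a homotopy moves it along a path of projections or unitaries. So `g ∘ f` and `f ∘ g`
induce the identity on `K₀` and `K₁`.
-/

section SeparableSubalgebras

theorem countable_subsemigroupClosure {M : Type*} [Semigroup M] {s : Set M} (hs : s.Countable) :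
    (Subsemigroup.closure s : Set M).Countable := by
  have : Countable s := hs.to_subtype
  have : Countable (FreeSemigroup s) :=
    Function.Injective.countable (f := fun x : FreeSemigroup s => (x.head, x.tail))
      fun x y h => FreeSemigroup.ext (congrArg Prod.fst h) (congrArg Prod.snd h)
  have closure_le : Subsemigroup.closure s ≤ (FreeSemigroup.lift ((↑) : s → M)).srange :=
    Subsemigroup.closure_le.2 fun x hx => ⟨FreeSemigroup.of ⟨x, hx⟩, FreeSemigroup.lift_of _ _⟩
  exact (Set.countable_range (FreeSemigroup.lift ((↑) : s → M))).mono closure_le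

theorem isSeparable_starAdjoin (R : Type*) {A : Type*} [CommSemiring R] [StarRing R]
    [TopologicalSpace R] [TopologicalSpace.SeparableSpace R] [NonUnitalSemiring A] [StarRing A]
    [Module R A] [IsScalarTower R A A] [SMulCommClass R A A] [StarModule R A]
    [TopologicalSpace A] [ContinuousAdd A] [ContinuousSMul R A] {s : Set A} (hs : s.Countable) :
    TopologicalSpace.IsSeparable (NonUnitalStarAlgebra.adjoin R s : Set A) := by
  have hstar : (star s).Countable := by
    rw [← Set.image_star]
    exact hs.image star
  have hspan := (countable_subsemigroupClosure (hs.union hstar)).isSeparable.span (R := R)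
  rwa [← NonUnitalStarAlgebra.adjoin_eq_span] at hspan

variable {A : Type*} [NonUnitalCStarAlgebra A]

instance separableSpace_elemental (a : A) :
    TopologicalSpace.SeparableSpace (NonUnitalStarAlgebra.elemental ℂ a) :=
  (isSeparable_starAdjoin ℂ (Set.countable_singleton a)).closure.separableSpace

theorem exists_separable_starSubalgebra {s : Set A} (hs : s.Countable) :
    ∃ S : NonUnitalStarSubalgebra ℂ A,
      IsClosed (S : Set A) ∧ TopologicalSpace.SeparableSpace S ∧ s ⊆ S :=
  ⟨(NonUnitalStarAlgebra.adjoin ℂ s).topologicalClosure,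
    NonUnitalStarSubalgebra.isClosed_topologicalClosure _,
    (isSeparable_starAdjoin ℂ hs).closure.separableSpace,
    (NonUnitalStarAlgebra.subset_adjoin ℂ s).trans
      (NonUnitalStarSubalgebra.le_topologicalClosure _)⟩

end SeparableSubalgebras

section Gluing

/-- The `*`-homomorphism whose underlying function is `φ`, given that any two points lie in a
`*`-subalgebra on which `φ` restricts to a `*`-homomorphism. -/
def starAlgHomOfLocal {R A B : Type*} [CommSemiring R] [NonUnitalNonAssocSemiring A] [Star A]
    [Module R A] [NonUnitalNonAssocSemiring B] [Star B] [Module R B] (φ : A → B)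
    (hφ : ∀ a b : A, ∃ (S : NonUnitalStarSubalgebra R A) (k : S →⋆ₙₐ[R] B),
      a ∈ S ∧ b ∈ S ∧ ∀ x : S, k x = φ x) : A →⋆ₙₐ[R] B where
  toFun := φ
  map_smul' r a := by
    obtain ⟨S, k, ha, -, hk⟩ := hφ a a
    simpa only [hk] using! map_smul k r ⟨a, ha⟩
  map_zero' := by
    obtain ⟨S, k, -, -, hk⟩ := hφ 0 0
    simpa only [hk] using! map_zero k
  map_add' a b := by
    obtain ⟨S, k, ha, hb, hk⟩ := hφ a b
    simpa only [hk] using! map_add k ⟨a, ha⟩ ⟨b, hb⟩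
  map_mul' a b := by
    obtain ⟨S, k, ha, hb, hk⟩ := hφ a b
    simpa only [hk] using! map_mul k ⟨a, ha⟩ ⟨b, hb⟩
  map_star' a := by
    obtain ⟨S, k, ha, -, hk⟩ := hφ a a
    simpa only [hk] using! map_star k ⟨a, ha⟩

end Gluing

namespace SeparableHomMap

open scoped CStarAlgebra

variable {A B : Type u} [NonUnitalCStarAlgebra A] [NonUnitalCStarAlgebra B]

/-- The value at `a` of the image under `φ` of the inclusion of the C⋆-subalgebra generated by
`a`. -/
noncomputable def value (φ : SeparableHomMap A B) (a : A) : B :=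
  φ (NonUnitalStarAlgebra.elemental ℂ a) (NonUnitalStarSubalgebraClass.subtype _)
    ⟨a, NonUnitalStarAlgebra.elemental.self_mem ℂ a⟩

variable {φ : SeparableHomMap A B}

theorem IsNatural.apply_eq_value (hφ : φ.IsNatural) {C : Type u} [NonUnitalCStarAlgebra C]
    [TopologicalSpace.SeparableSpace C] (f : C →⋆ₙₐ[ℂ] A) (c : C) : φ C f c = φ.value (f c) := by
  let ι : NonUnitalStarAlgebra.elemental ℂ c →⋆ₙₐ[ℂ] C := NonUnitalStarSubalgebraClass.subtype _
  have f_maps_elemental : NonUnitalStarAlgebra.elemental ℂ c ≤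
      (NonUnitalStarAlgebra.elemental ℂ (f c)).comap f :=
    NonUnitalStarAlgebra.elemental.le_of_mem
      ((NonUnitalStarAlgebra.elemental.isClosed ℂ (f c)).preimage (map_continuous f))
      (NonUnitalStarAlgebra.elemental.self_mem ℂ (f c))
  let f' : NonUnitalStarAlgebra.elemental ℂ c →⋆ₙₐ[ℂ] NonUnitalStarAlgebra.elemental ℂ (f c) :=
    NonUnitalStarAlgHom.codRestrict (f.comp ι) _ fun x => f_maps_elemental x.2
  have factorization : (φ C f).comp ι =
      (φ _ (NonUnitalStarSubalgebraClass.subtype _)).comp f' :=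
    calc (φ C f).comp ι = φ _ (f.comp ι) := (hφ _ _ _ _).symm
      _ = φ _ ((NonUnitalStarSubalgebraClass.subtype _).comp f') := rfl
      _ = _ := hφ _ _ _ _
  exact DFunLike.congr_fun factorization ⟨c, NonUnitalStarAlgebra.elemental.self_mem ℂ c⟩

theorem IsNatural.exists_starAlgHom_eq_value (hφ : φ.IsNatural) (a b : A) :
    ∃ (S : NonUnitalStarSubalgebra ℂ A) (k : S →⋆ₙₐ[ℂ] B),
      a ∈ S ∧ b ∈ S ∧ ∀ x : S, k x = φ.value x := by
  obtain ⟨S, _, _, hS⟩ := exists_separable_starSubalgebra (Set.toFinite {a, b}).countable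
  exact ⟨S, φ S (NonUnitalStarSubalgebraClass.subtype S), hS (by simp), hS (by simp),
    hφ.apply_eq_value _⟩

theorem IsNatural.exists_eq_comp (hφ : φ.IsNatural) :
    ∃ f : A →⋆ₙₐ[ℂ] B, ∀ (C : Type u) [NonUnitalCStarAlgebra C]
      [TopologicalSpace.SeparableSpace C] (k : C →⋆ₙₐ[ℂ] A), φ C k = f.comp k :=
  ⟨starAlgHomOfLocal φ.value hφ.exists_starAlgHom_eq_value, fun _ _ _ k =>
    NonUnitalStarAlgHom.ext (hφ.apply_eq_value k)⟩

end SeparableHomMap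

section WeakHomotopy

/-- Weak homotopy of `*`-homomorphisms `A → B`: their compositions with every `*`-homomorphism from
a separable C⋆-algebra to `A` are homotopic. -/
def WeaklyHomotopic {A : Type u} {B : Type v} [NonUnitalCStarAlgebra A] [NonUnitalCStarAlgebra B]
    (f g : A →⋆ₙₐ[ℂ] B) : Prop :=
  ∀ (C : Type u) [NonUnitalCStarAlgebra C] [TopologicalSpace.SeparableSpace C]
    (k : C →⋆ₙₐ[ℂ] A), StarHomotopic (f.comp k) (g.comp k)

theorem WeaklyHomotopyEquivalent.exists_inverse_up_to_weaklyHomotopic {A B : Type u}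
    [NonUnitalCStarAlgebra A] [NonUnitalCStarAlgebra B] (h : WeaklyHomotopyEquivalent A B) :
    ∃ (f : A →⋆ₙₐ[ℂ] B) (g : B →⋆ₙₐ[ℂ] A),
      WeaklyHomotopic (g.comp f) (.id ℂ A) ∧ WeaklyHomotopic (f.comp g) (.id ℂ B) := by
  obtain ⟨φ, ψ, hφ, hψ, -, -, hψφ, hφψ⟩ := h
  obtain ⟨f, hf⟩ := hφ.exists_eq_comp
  obtain ⟨g, hg⟩ := hψ.exists_eq_comp
  refine ⟨f, g, fun C _ _ k => ?_, fun C _ _ k => ?_⟩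
  · simpa only [hf, hg] using! hψφ C k
  · simpa only [hf, hg] using! hφψ C k

end WeakHomotopy

namespace KTheory

section MatrixMaps

variable {R A B ι : Type*} [CommSemiring R] [Semiring A] [StarRing A] [Algebra R A]
  [Semiring B] [StarRing B] [Algebra R B] [Fintype ι] [DecidableEq ι]

/-- Entrywise application of a unital `*`-homomorphism, as a unital `*`-homomorphism of matrix
algebras. -/
def matrixStarAlgHom (f : A →⋆ₐ[R] B) : Matrix ι ι A →⋆ₐ[R] Matrix ι ι B :=
  { f.toAlgHom.mapMatrix with
    map_star' := fun _ => Matrix.conjTranspose_map f (map_star f) }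

theorem matrixStarAlgHom_injective {f : A →⋆ₐ[R] B} (hf : Function.Injective f) :
    Function.Injective (matrixStarAlgHom f : Matrix ι ι A →⋆ₐ[R] Matrix ι ι B) :=
  Matrix.map_injective hf

end MatrixMaps

section Reflection

variable {A B F : Type*} [FunLike F A B] {f : F}

theorem isStarProjection_of_map [Mul A] [Star A] [Mul B] [Star B] [MulHomClass F A B]
    [StarHomClass F A B] (hf : Function.Injective f) {p : A} (hp : IsStarProjection (f p)) :
    IsStarProjection p where
  isIdempotentElem := hf <| by rw [map_mul, hp.isIdempotentElem.eq]
  isSelfAdjoint := hf <| by rw [map_star, hp.isSelfAdjoint.star_eq]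

theorem mem_unitary_of_map [Monoid A] [StarMul A] [Monoid B] [StarMul B] [MonoidHomClass F A B]
    [StarHomClass F A B] (hf : Function.Injective f) {w : A} (hw : f w ∈ unitary B) :
    w ∈ unitary A := by
  simp only [Unitary.mem_iff, ← map_star, ← map_mul, ← map_one f, hf.eq_iff] at hw
  exact Unitary.mem_iff.2 hw

end Reflection

section MatrixPaths

/-- Evaluation at a point, as a `*`-homomorphism `C(X, B) → B`. -/
def evalStarAlgHom {X B : Type*} [TopologicalSpace X] [NonUnitalCStarAlgebra B] (x : X) :
    C(X, B) →⋆ₙₐ[ℂ] B where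
  toFun F := F x
  map_smul' _ _ := rfl
  map_zero' := rfl
  map_add' _ _ := rfl
  map_mul' _ _ := rfl
  map_star' _ := rfl

variable {A B C : Type*} [NonUnitalCStarAlgebra A] [NonUnitalCStarAlgebra B]
  [NonUnitalCStarAlgebra C]

theorem continuous_starMap_apply {X : Type*} [TopologicalSpace X] {G : X → C →⋆ₙₐ[ℂ] B}
    (hG : ∀ c, Continuous fun t => G t c) (x : Unitization ℂ C) :
    Continuous fun t => Unitization.starMap (G t) x := by
  induction x using Unitization.ind with
  | inl_add_inr r c =>
    simp only [map_add, Unitization.starMap_inl, Unitization.starMap_inr]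
    exact continuous_const.add (Unitization.continuous_inr.comp (hG c))

theorem _root_.StarHomotopic.joinedIn_map {f₀ f₁ : C →⋆ₙₐ[ℂ] B} (h : StarHomotopic f₀ f₁)
    {m n : Type*} (x : Matrix m n (Unitization ℂ C)) {P : Set (Matrix m n (Unitization ℂ B))}
    (hP : ∀ F : Unitization ℂ C →⋆ₐ[ℂ] Unitization ℂ B, x.map F ∈ P) :
    JoinedIn P (x.map (Unitization.starMap f₀)) (x.map (Unitization.starMap f₁)) := by
  obtain ⟨F, hF₀, hF₁⟩ := h
  let G (t : I) : C →⋆ₙₐ[ℂ] B := (evalStarAlgHom t).comp F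
  have hG₀ : G 0 = f₀ := NonUnitalStarAlgHom.ext hF₀
  have hG₁ : G 1 = f₁ := NonUnitalStarAlgHom.ext hF₁
  have hcont : Continuous fun t => x.map (Unitization.starMap (G t)) :=
    continuous_matrix fun i j => continuous_starMap_apply (fun c => (F c).continuous) (x i j)
  exact ⟨⟨⟨_, hcont⟩, congrArg (fun f => x.map (Unitization.starMap f)) hG₀,
    congrArg (fun f => x.map (Unitization.starMap f)) hG₁⟩, fun t => hP (Unitization.starMap (G t))⟩

theorem map_starMap_comp {m n : Type*} (g : B →⋆ₙₐ[ℂ] C) (f : A →⋆ₙₐ[ℂ] B)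
    (x : Matrix m n (Unitization ℂ A)) :
    x.map (Unitization.starMap (g.comp f)) =
      (x.map (Unitization.starMap f)).map (Unitization.starMap g) := by
  rw [Unitization.starMap_comp, Matrix.map_map]
  rfl

theorem starMap_subtype_injective (S : NonUnitalStarSubalgebra ℂ A) :
    Function.Injective (Unitization.starMap (R := ℂ) (NonUnitalStarSubalgebraClass.subtype S)) :=
  Unitization.starMap_injective Subtype.val_injective

theorem exists_separable_map_subtype_eq {m n : Type*} [Countable m] [Countable n]
    (x : Matrix m n (Unitization ℂ A)) :
    ∃ (S : NonUnitalStarSubalgebra ℂ A) (_ : IsClosed (S : Set A))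
      (_ : TopologicalSpace.SeparableSpace S) (y : Matrix m n (Unitization ℂ S)),
      y.map (Unitization.starMap (NonUnitalStarSubalgebraClass.subtype S)) = x := by
  obtain ⟨S, hclosed, hsep, hS⟩ :=
    exists_separable_starSubalgebra (Set.countable_range fun ij : m × n => (x ij.1 ij.2).snd)
  refine ⟨S, hclosed, hsep, Matrix.of fun i j =>
    Unitization.inl (x i j).fst + Unitization.inr ⟨(x i j).snd, hS ⟨(i, j), rfl⟩⟩, ?_⟩
  ext1 i j
  rw [Matrix.map_apply, Matrix.of_apply, map_add, Unitization.starMap_inl, Unitization.starMap_inr]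
  exact Unitization.inl_fst_add_inr_snd_eq (x i j)

end MatrixPaths

section WeakHomotopyPaths

variable {A : Type u} {B : Type v} [NonUnitalCStarAlgebra A] [NonUnitalCStarAlgebra B]
  {f g : A →⋆ₙₐ[ℂ] B} {n : ℕ}

theorem _root_.WeaklyHomotopic.joinedIn_isStarProjection (h : WeaklyHomotopic f g)
    {p : Matrix (Fin n) (Fin n) (Unitization ℂ A)} (hp : IsStarProjection p) :
    JoinedIn {r | IsStarProjection r} (p.map (Unitization.starMap f))
      (p.map (Unitization.starMap g)) := by
  obtain ⟨S, _, _, q, rfl⟩ := exists_separable_map_subtype_eq p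
  have hq : IsStarProjection q :=
    isStarProjection_of_map (f := matrixStarAlgHom _)
      (matrixStarAlgHom_injective (starMap_subtype_injective S)) hp
  rw [← map_starMap_comp, ← map_starMap_comp]
  exact (h S (NonUnitalStarSubalgebraClass.subtype S)).joinedIn_map q
    fun F => isStarProjection_map F hq

theorem _root_.WeaklyHomotopic.joinedIn_unitary (h : WeaklyHomotopic f g)
    {w : Matrix (Fin n) (Fin n) (Unitization ℂ A)}
    (hw : w ∈ unitary (Matrix (Fin n) (Fin n) (Unitization ℂ A))) :
    JoinedIn (unitary (Matrix (Fin n) (Fin n) (Unitization ℂ B)) : Set (Matrix (Fin n) (Fin n) _))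
      (w.map (Unitization.starMap f)) (w.map (Unitization.starMap g)) := by
  obtain ⟨S, _, _, z, rfl⟩ := exists_separable_map_subtype_eq w
  have hz : z ∈ unitary (Matrix (Fin n) (Fin n) (Unitization ℂ S)) :=
    mem_unitary_of_map (f := matrixStarAlgHom _)
      (matrixStarAlgHom_injective (starMap_subtype_injective S)) hw
  rw [← map_starMap_comp, ← map_starMap_comp]
  exact (h S (NonUnitalStarSubalgebraClass.subtype S)).joinedIn_map z
    fun F => Unitary.map_mem (matrixStarAlgHom F) hz

end WeakHomotopyPaths

section UnitalFunctoriality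

open scoped CStarAlgebra

variable {A B C : Type*} [CStarAlgebra A] [CStarAlgebra B] [CStarAlgebra C]

/-- The class `[p] ∈ K₀(A)` of a matrix projection. -/
def K0Unital.mk (p : MatProj A) : K0Unital A :=
  QuotientAddGroup.mk (FreeAbelianGroup.of p)

theorem K0Unital.mk_eq_mk_of_joinedIn {n : ℕ} {p q : Matrix (Fin n) (Fin n) A}
    (hp : IsStarProjection p) (hq : IsStarProjection q)
    (h : JoinedIn {r | IsStarProjection r} p q) :
    K0Unital.mk ⟨n, p, hp⟩ = K0Unital.mk ⟨n, q, hq⟩ :=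
  QuotientAddGroup.eq_iff_sub_mem.2 (AddSubgroup.subset_closure (K0Rel.path p q hp hq h))

theorem K0Unital.addMonoidHom_ext {G : Type*} [AddCommGroup G] {f g : K0Unital A →+ G}
    (h : ∀ p : MatProj A, f (K0Unital.mk p) = g (K0Unital.mk p)) : f = g :=
  QuotientAddGroup.addMonoidHom_ext _ (FreeAbelianGroup.lift_ext _ _ h)

theorem K0Unital.map_mk (f : A →⋆ₐ[ℂ] B) (p : MatProj A) :
    K0Unital.map f (K0Unital.mk p) = K0Unital.mk (p.map f) := by
  simp [K0Unital.map, K0Unital.mk]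

theorem K0Unital.map_id : K0Unital.map (StarAlgHom.id ℂ A) = AddMonoidHom.id _ :=
  K0Unital.addMonoidHom_ext fun p => K0Unital.map_mk _ p

theorem K0Unital.map_comp (g : B →⋆ₐ[ℂ] C) (f : A →⋆ₐ[ℂ] B) :
    K0Unital.map (g.comp f) = (K0Unital.map g).comp (K0Unital.map f) :=
  K0Unital.addMonoidHom_ext fun p => by
    simp only [AddMonoidHom.comp_apply, K0Unital.map_mk]
    rfl

/-- Entrywise application of a unital `*`-homomorphism to matrix unitaries. -/
def MatUnitary.map (f : A →⋆ₐ[ℂ] B) (w : MatUnitary A) : MatUnitary B :=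
  ⟨w.1, w.2.1.map f, Unitary.map_mem (matrixStarAlgHom f) w.2.2⟩

theorem K1Rel.map (f : A →⋆ₐ[ℂ] B) {x : FreeAbelianGroup (MatUnitary A)} (hx : K1Rel A x) :
    K1Rel B (FreeAbelianGroup.map (MatUnitary.map f) x) := by
  cases hx with
  | path w z hw hz h =>
    simp only [map_sub, FreeAbelianGroup.map_of_apply, MatUnitary.map]
    have hpath := h.map (continuous_id.matrix_map (map_continuous f))
    exact K1Rel.path _ _ _ _ <| hpath.mono <|
      Set.image_subset_iff.2 fun _ => Unitary.map_mem (matrixStarAlgHom f)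
  | one n =>
    simp only [FreeAbelianGroup.map_of_apply, MatUnitary.map,
      Matrix.map_one f (map_zero f) (map_one f)]
    exact K1Rel.one n
  | sum w z hw hz =>
    simp only [map_sub, map_add, FreeAbelianGroup.map_of_apply, MatUnitary.map, map_blockSum]
    exact K1Rel.sum _ _ _ _

/-- The homomorphism `K₁(A) → K₁(B)` induced by a unital `*`-homomorphism `A → B`. -/
def K1Unital.map (f : A →⋆ₐ[ℂ] B) : K1Unital A →+ K1Unital B :=
  QuotientAddGroup.map _ _ (FreeAbelianGroup.map (MatUnitary.map f)) <|
    (AddSubgroup.closure_le _).2 fun _ hx => AddSubgroup.subset_closure (K1Rel.map f hx)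

/-- The class `[w] ∈ K₁(A)` of a matrix unitary. -/
def K1Unital.mk (w : MatUnitary A) : K1Unital A :=
  QuotientAddGroup.mk (FreeAbelianGroup.of w)

theorem K1Unital.mk_eq_mk_of_joinedIn {n : ℕ} {w z : Matrix (Fin n) (Fin n) A}
    (hw : w ∈ unitary (Matrix (Fin n) (Fin n) A)) (hz : z ∈ unitary (Matrix (Fin n) (Fin n) A))
    (h : JoinedIn (unitary (Matrix (Fin n) (Fin n) A) : Set (Matrix (Fin n) (Fin n) A)) w z) :
    K1Unital.mk ⟨n, w, hw⟩ = K1Unital.mk ⟨n, z, hz⟩ :=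
  QuotientAddGroup.eq_iff_sub_mem.2 (AddSubgroup.subset_closure (K1Rel.path w z hw hz h))

theorem K1Unital.addMonoidHom_ext {G : Type*} [AddCommGroup G] {f g : K1Unital A →+ G}
    (h : ∀ w : MatUnitary A, f (K1Unital.mk w) = g (K1Unital.mk w)) : f = g :=
  QuotientAddGroup.addMonoidHom_ext _ (FreeAbelianGroup.lift_ext _ _ h)

theorem K1Unital.map_mk (f : A →⋆ₐ[ℂ] B) (w : MatUnitary A) :
    K1Unital.map f (K1Unital.mk w) = K1Unital.mk (w.map f) := by
  simp [K1Unital.map, K1Unital.mk]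

theorem K1Unital.map_id : K1Unital.map (StarAlgHom.id ℂ A) = AddMonoidHom.id _ :=
  K1Unital.addMonoidHom_ext fun w => K1Unital.map_mk _ w

theorem K1Unital.map_comp (g : B →⋆ₐ[ℂ] C) (f : A →⋆ₐ[ℂ] B) :
    K1Unital.map (g.comp f) = (K1Unital.map g).comp (K1Unital.map f) :=
  K1Unital.addMonoidHom_ext fun w => by
    simp only [AddMonoidHom.comp_apply, K1Unital.map_mk]
    rfl

end UnitalFunctoriality

section NonUnitalFunctoriality

variable {A : Type u} {B : Type v} {C : Type*} [NonUnitalCStarAlgebra A] [NonUnitalCStarAlgebra B]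
  [NonUnitalCStarAlgebra C]

theorem augmentation_comp_starMap (f : A →⋆ₙₐ[ℂ] B) :
    (augmentation B).comp (Unitization.starMap f) = augmentation A := by
  refine StarAlgHom.ext fun x => ?_
  change (Unitization.starMap f x).fst = x.fst
  induction x using Unitization.ind with
  | inl_add_inr r a => simp [Unitization.algebraMap_eq_inl]

/-- The homomorphism `K₀(A) → K₀(B)` induced by a `*`-homomorphism `A → B`. -/
noncomputable def K0.map (f : A →⋆ₙₐ[ℂ] B) : K0 A →+ K0 B :=
  ((K0Unital.map (Unitization.starMap f)).comp (AddSubgroup.subtype _)).codRestrict _ fun x => by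
    rw [AddMonoidHom.mem_ker, AddMonoidHom.comp_apply, ← AddMonoidHom.comp_apply (K0Unital.map _),
      ← K0Unital.map_comp, augmentation_comp_starMap]
    exact x.2

theorem K0.coe_map (f : A →⋆ₙₐ[ℂ] B) (x : K0 A) :
    (K0.map f x : K0Unital (Unitization ℂ B)) = K0Unital.map (Unitization.starMap f) x :=
  rfl

theorem K0.map_id : K0.map (NonUnitalStarAlgHom.id ℂ A) = AddMonoidHom.id _ := by
  ext x
  rw [K0.coe_map, Unitization.starMap_id, K0Unital.map_id]
  rfl

theorem K0.map_comp (g : B →⋆ₙₐ[ℂ] C) (f : A →⋆ₙₐ[ℂ] B) :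
    K0.map (g.comp f) = (K0.map g).comp (K0.map f) := by
  ext x
  rw [K0.coe_map, Unitization.starMap_comp, K0Unital.map_comp]
  rfl

theorem K0.map_eq_of_weaklyHomotopic {f g : A →⋆ₙₐ[ℂ] B} (h : WeaklyHomotopic f g) :
    K0.map f = K0.map g := by
  have hunital : K0Unital.map (Unitization.starMap f) = K0Unital.map (Unitization.starMap g) :=
    K0Unital.addMonoidHom_ext fun ⟨n, p, hp⟩ => by
      rw [K0Unital.map_mk, K0Unital.map_mk]
      exact K0Unital.mk_eq_mk_of_joinedIn _ _ (h.joinedIn_isStarProjection hp)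
  ext x
  rw [K0.coe_map, K0.coe_map, hunital]

/-- The homomorphism `K₁(A) → K₁(B)` induced by a `*`-homomorphism `A → B`. -/
noncomputable def K1.map (f : A →⋆ₙₐ[ℂ] B) : K1 A →+ K1 B :=
  K1Unital.map (Unitization.starMap f)

theorem K1.map_id : K1.map (NonUnitalStarAlgHom.id ℂ A) = AddMonoidHom.id _ := by
  rw [K1.map, Unitization.starMap_id, K1Unital.map_id]

theorem K1.map_comp (g : B →⋆ₙₐ[ℂ] C) (f : A →⋆ₙₐ[ℂ] B) :
    K1.map (g.comp f) = (K1.map g).comp (K1.map f) := by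
  rw [K1.map, Unitization.starMap_comp, K1Unital.map_comp]
  rfl

theorem K1.map_eq_of_weaklyHomotopic {f g : A →⋆ₙₐ[ℂ] B} (h : WeaklyHomotopic f g) :
    K1.map f = K1.map g :=
  K1Unital.addMonoidHom_ext fun ⟨n, w, hw⟩ => by
    rw [K1.map, K1.map, K1Unital.map_mk, K1Unital.map_mk]
    exact K1Unital.mk_eq_mk_of_joinedIn _ _ (h.joinedIn_unitary hw)

end NonUnitalFunctoriality

section WeakHomotopyInvariance

variable {A : Type u} {B : Type v} [NonUnitalCStarAlgebra A] [NonUnitalCStarAlgebra B]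
  {f : A →⋆ₙₐ[ℂ] B} {g : B →⋆ₙₐ[ℂ] A}

theorem K0.map_comp_map_eq_id (h : WeaklyHomotopic (g.comp f) (.id ℂ A)) :
    (K0.map g).comp (K0.map f) = AddMonoidHom.id _ := by
  rw [← K0.map_comp, K0.map_eq_of_weaklyHomotopic h, K0.map_id]

theorem K1.map_comp_map_eq_id (h : WeaklyHomotopic (g.comp f) (.id ℂ A)) :
    (K1.map g).comp (K1.map f) = AddMonoidHom.id _ := by
  rw [← K1.map_comp, K1.map_eq_of_weaklyHomotopic h, K1.map_id]

end WeakHomotopyInvariance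

end KTheory

theorem mainTheorem10 {A B : Type u} [NonUnitalCStarAlgebra A] [NonUnitalCStarAlgebra B]
    (h : WeaklyHomotopyEquivalent A B) :
    Nonempty (KTheory.K0 A ≃+ KTheory.K0 B) ∧ Nonempty (KTheory.K1 A ≃+ KTheory.K1 B) := by
  obtain ⟨f, g, hgf, hfg⟩ := h.exists_inverse_up_to_weaklyHomotopic
  exact ⟨⟨(KTheory.K0.map f).toAddEquiv (KTheory.K0.map g)
      (KTheory.K0.map_comp_map_eq_id hgf) (KTheory.K0.map_comp_map_eq_id hfg)⟩,
    ⟨(KTheory.K1.map f).toAddEquiv (KTheory.K1.map g)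
      (KTheory.K1.map_comp_map_eq_id hgf) (KTheory.K1.map_comp_map_eq_id hfg)⟩⟩
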